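/- Let $\sigma:\mathbb{R}\to\mathbb{R}$ be continuous and not a polynomial, and let $d,d_i,d_o,L\ge 0$ be integers. Let $D$ be either a compact subset of $\mathbb{R}^d$ such that every nonempty relatively open subset of $D$ has positive Lebesgue measure (for instance, the closure of a bounded open set), or the torus $\mathbb{T}^d=(\mathbb{R}/T\mathbb{Z})^d$ with $T>0$. Let $p(x)=x\in\mathbb{R}^d$ if $D\subset\mathbb{R}^d$, and let $p:\mathbb{T}^d\to\mathbb{R}^m$ be any continuous injective map (e.g. cosines and sines of the coordinates) if $D=\mathbb{T}^d$. *Architecture.* A shallow network of width $H$ is a map $\xi\mapsto C\sigma(A\xi+b)+c$ with $H$ hidden neurons, $\sigma$ acting componentwise. A convolutional neural operator of channel width $H$ is $$\Psi(u)=\mathcal{Q}\circ\mathcal{L}_L\circ\dots\circ\mathcal{L}_1\circ\mathcal{R}(u),\qquad \mathcal{R}(u)(x)=R(u(x),p(x)),\quad \mathcal{Q}(v)(x)=Q(v(x)),$$ $$\mathcal{L}_\ell(v)(x)=\sigma\Big(W_\ell v(x)+b_\ell+\int_D\kappa_\ell(x-y;\theta_\ell)\,v(y)\,dy\Big),$$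 where $R:\mathbb{R}^{d_i}\times\mathbb{R}^{d\text{ or }m}\to\mathbb{R}^H$ and $Q:\mathbb{R}^H\to\mathbb{R}^{d_o}$ are shallow networks of width $H$, $W_\ell\in\mathbb{R}^{H\times H}$, $b_\ell\in\mathbb{R}^H$. An architecture prescribes, for every $H$ and every $\ell$, a parametrized family of $H\times H$-matrix-valued kernels $\kappa_\ell(\,\cdot\,;\theta_\ell)$. The entries of a kernel are integrable functions or, more generally, finite signed Borel measures (this covers factorized kernels $\kappa(x_j)\prod_{k\ne j}\delta(x_k)$); convolution with them over $D$ is required to map continuous functions on $D$ to continuous functions on $D$, which is automatic for integrable functions and on the torus. *Full field of view.* The architecture has a full field of view if there are scalar kernels $g_1,\dots,g_L$ such that 1. the iterated convolution over $D$, $f\mapsto g_L*(\dots*(g_1*f))$ with $(g*f)(x)=\int_D g(x-y)f(y)\,dy$, is an integral operator $f\mapsto\int_D\bar g(x,y)f(y)\,dy$ on $C(D)$ whose kernel vanishes nowhere: $\bar g(x,\cdot)$ is integrable for each $x\in D$, and $\bar g(x,y)\ne0$ for all $x,y\in D$ (on the torus, $\bar g(x,y)=(g_L*\dots*g_1)(x-y)$);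 2. for every channel width $H$ and all $A_1,\dots,A_L\in\mathbb{R}^{H\times H}$ with $A_L\cdots A_1\ne0$ there are parameters $\theta_\ell$ such that $\kappa_\ell(\,\cdot\,;\theta_\ell)=g_\ell A_\ell$ for $\ell=1,\dots,L$. **Theorem.** Let $\Psi$ be a (factorized) convolutional neural operator architecture with a full field of view, let $\mathcal{G}:C(D;\mathbb{R}^{d_i})\to C(D;\mathbb{R}^{d_o})$ be a continuous operator and let $\mathcal{K}\subset C(D;\mathbb{R}^{d_i})$ be compact. Then for every $\epsilon>0$ there exist a channel width $H$ and a setting of the weights of $\Psi$ such that $$\sup_{u\in\mathcal{K}}\ \sup_{x\in D}\ |\mathcal{G}(u)(x)-\Psi(u)(x)|\le\epsilon .$$ -/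

import Mathlib

open MeasureTheory

universe u

/-!
Convolutional neural operators on a compact domain.

The domain is a type `X` of points together with an inclusion `ι : X → E` into an additive group `E`
in which differences of points are taken.  Two instances are used: a compact set `D ⊆ ℝᵈ` with
`ι : D → ℝᵈ` the inclusion, and the torus `X = E = 𝕋ᵈ` with `ι` the identity.
-/

/-- Convolution over the domain of a scalar function `f` with a scalar kernel `μ`, a finite signed
Borel measure: the value at `x` is the integral of `f (x - z)` against `dμ(z)` over all `z` for which
`x - z` lies in the domain (`Function.extend ι f 0` is `f`, extended by `0` outside of the domain).

For an ordinary kernel, `dμ(z) = g(z) dz`, this is the integral of `g(x - y) f(y) dy` over the domain.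
For a factorized kernel `g(x_j) ∏_{k ≠ j} δ(x_k)`, it is a one-dimensional convolution along the
`j`-th coordinate axis. -/
noncomputable def domainConv {X E : Type*} [AddCommGroup E] [MeasurableSpace E] (ι : X → E)
    (μ : SignedMeasure E) (f : X → ℝ) (x : X) : ℝ :=
  ∫ᵛ z, Function.extend ι f 0 (ι x - z) ∂<•μ

/-- `composeLayers L F` is the composition `F_L ∘ ⋯ ∘ F_1` of `L` maps; `F 0` is applied first. -/
def composeLayers {S : Type*} : (L : ℕ) → (Fin L → S → S) → S → S
  | 0, _, s => s
  | L + 1, F, s => F (Fin.last L) (composeLayers L (fun ℓ => F ℓ.castSucc) s)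

/-- The matrix product `A_L ⋯ A_1`; `A 0` is the rightmost factor. -/
def layerProduct {H L : ℕ} (A : Fin L → Matrix (Fin H) (Fin H) ℝ) : Matrix (Fin H) (Fin H) ℝ :=
  composeLayers L (fun ℓ M => A ℓ * M) 1

/-- The iterated convolution `g_L ∗ ⋯ ∗ g_1` over the domain (all integrals over the domain, as in
the layers of the network) has the kernel `k`:
`(g_L ∗ (⋯ ∗ (g_1 ∗ f)))(x) = ∫ k(x, y) f(y) dy` for all continuous `f` and all `x`.
Here `ν` is the Lebesgue measure of the domain.  For ordinary kernels, `k(x, y)` is the integral of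
`g_L(x - y_{L-1}) ⋯ g_2(y_2 - y_1) g_1(y_1 - y)` over all `y_1, …, y_{L-1}` in the domain; on the
torus this is the function `g_L ∗ ⋯ ∗ g_1` at `x - y`. -/
def IsIteratedKernel {X E : Type*} [TopologicalSpace X] [MeasurableSpace X] [AddCommGroup E]
    [MeasurableSpace E] (ι : X → E) (ν : Measure X) {L : ℕ} (g : Fin L → SignedMeasure E)
    (k : X → X → ℝ) : Prop :=
  (∀ x, Integrable (k x) ν) ∧
    ∀ (f : C(X, ℝ)) (x : X),
      composeLayers L (fun ℓ => domainConv ι (g ℓ)) f x = ∫ y, k x y * f y ∂ν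

/-- A convolutional neural operator architecture with `L` hidden layers: for every channel width `H`
and every layer `ℓ`, a set of parameters, and for every parameter `θ` a matrix-valued convolution
kernel `κ_ℓ(·; θ)` of size `H × H`.  The entries are finite signed measures, so that ordinary kernels
(densities) and factorized ones (with Dirac factors) are both covered. The only requirement is that
the hidden layers are maps between spaces of continuous functions on the domain; it holds by itself
for kernels that are integrable functions, and for all kernels on the torus. -/
structure ConvArchitecture {X E : Type*} [TopologicalSpace X] [AddCommGroup E] [MeasurableSpace E]
    (ι : X → E) (L : ℕ) where
  /-- The parameters of the kernel of layer `ℓ` at channel width `H`. -/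
  Param : (H : ℕ) → Fin L → Type u
  /-- The matrix-valued kernel `κ_ℓ(·; θ)`. -/
  kernel : (H : ℕ) → (ℓ : Fin L) → Param H ℓ → Matrix (Fin H) (Fin H) (SignedMeasure E)
  /-- Convolution with the kernel over the domain maps continuous functions to continuous ones. -/
  continuous_conv : ∀ (H : ℕ) (ℓ : Fin L) (θ : Param H ℓ) (i j : Fin H) (f : C(X, ℝ)),
    Continuous (domainConv ι (kernel H ℓ θ i j) f)

/-- Full field of view: there are scalar kernels `g_1, …, g_L` whose iterated convolution vanishes
nowhere, and such that for every channel width `H` and all `H × H` matrices with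
`A_L ⋯ A_1 ≠ 0` there are parameters with `κ_ℓ(·; θ_ℓ) = g_ℓ A_ℓ` for every layer `ℓ`. -/
def ConvArchitecture.FullFieldOfView {X E : Type*} [TopologicalSpace X] [MeasurableSpace X]
    [AddCommGroup E] [MeasurableSpace E] {ι : X → E} {L : ℕ} (𝒜 : ConvArchitecture.{u} ι L)
    (ν : Measure X) : Prop :=
  ∃ g : Fin L → SignedMeasure E,
    (∃ k : X → X → ℝ, IsIteratedKernel ι ν g k ∧ ∀ x y, k x y ≠ 0) ∧
    ∀ (H : ℕ) (A : Fin L → Matrix (Fin H) (Fin H) ℝ), layerProduct A ≠ 0 →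
      ∀ ℓ, ∃ θ : 𝒜.Param H ℓ, ∀ i j, 𝒜.kernel H ℓ θ i j = A ℓ i j • g ℓ

/-- A shallow neural network (one hidden layer of `h` neurons) with inputs indexed by `a` and outputs
indexed by `c`. -/
structure ShallowNet (a h c : Type) where
  /-- Input weights. -/
  inWeight : Matrix h a ℝ
  /-- Biases of the neurons. -/
  inBias : h → ℝ
  /-- Output weights. -/
  outWeight : Matrix c h ℝ
  /-- Output biases. -/
  outBias : c → ℝ

/-- The function `ξ ↦ C σ(A ξ + b) + c` computed by a shallow network with activation `σ`. -/
def ShallowNet.eval {a h c : Type} [Fintype a] [Fintype h] (N : ShallowNet a h c) (σ : ℝ → ℝ)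
    (ξ : a → ℝ) : c → ℝ :=
  N.outWeight.mulVec (fun i => σ (N.inWeight.mulVec ξ i + N.inBias i)) + N.outBias

/-- The hidden layer `v ↦ σ(W v(x) + b + ∫_D κ(x - y) v(y) dy)`, with `σ` acting componentwise. -/
noncomputable def hiddenLayer {X E : Type*} [AddCommGroup E] [MeasurableSpace E] (ι : X → E)
    (σ : ℝ → ℝ) {H : ℕ} (W : Matrix (Fin H) (Fin H) ℝ) (b : Fin H → ℝ)
    (κ : Matrix (Fin H) (Fin H) (SignedMeasure E)) (v : X → Fin H → ℝ) : X → Fin H → ℝ :=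
  fun x i => σ (W.mulVec (v x) i + b i + ∑ j, domainConv ι (κ i j) (fun y => v y j) x)

/-- A setting of all weights of an architecture at channel width `H`: the lifting network `R` (inputs:
the `dᵢ` components of `u(x)` and the `m` position features of `x`), the projection network `Q`, and
`W_ℓ`, `b_ℓ`, `θ_ℓ` for every hidden layer.  The networks `R` and `Q` have width `H`. -/
structure ConvArchitecture.Weights {X E : Type*} [TopologicalSpace X] [AddCommGroup E]
    [MeasurableSpace E] {ι : X → E} {L : ℕ} (𝒜 : ConvArchitecture.{u} ι L) (dᵢ m dₒ H : ℕ) where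
  /-- The lifting network `R`. -/
  lift : ShallowNet (Fin dᵢ ⊕ Fin m) (Fin H) (Fin H)
  /-- The weight matrices `W_ℓ`. -/
  W : Fin L → Matrix (Fin H) (Fin H) ℝ
  /-- The bias vectors `b_ℓ`. -/
  b : Fin L → Fin H → ℝ
  /-- The kernel parameters `θ_ℓ`. -/
  θ : (ℓ : Fin L) → 𝒜.Param H ℓ
  /-- The projection network `Q`. -/
  proj : ShallowNet (Fin H) (Fin H) (Fin dₒ)

/-- The convolutional neural operator `Ψ(u) = 𝒬 ∘ ℒ_L ∘ ⋯ ∘ ℒ_1 ∘ ℛ(u)`, where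
`ℛ(u)(x) = R(u(x), p(x))` and `𝒬(v)(x) = Q(v(x))`.  The map `p` gives the coordinates by which the
position `x` enters the lifting network. -/
noncomputable def ConvArchitecture.Weights.operator {X E : Type*} [TopologicalSpace X]
    [AddCommGroup E] [MeasurableSpace E] {ι : X → E} {L : ℕ} {𝒜 : ConvArchitecture.{u} ι L}
    {dᵢ m dₒ H : ℕ} (w : 𝒜.Weights dᵢ m dₒ H) (σ : ℝ → ℝ) (p : X → Fin m → ℝ)
    (u : C(X, EuclideanSpace ℝ (Fin dᵢ))) (x : X) : EuclideanSpace ℝ (Fin dₒ) :=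
  WithLp.toLp 2 (w.proj.eval σ
    (composeLayers L
      (fun ℓ => hiddenLayer ι σ (w.W ℓ) (w.b ℓ) (𝒜.kernel H ℓ (w.θ ℓ)))
      (fun y => w.lift.eval σ (Sum.elim (fun i => u y i) (p y))) x))

/-- Universality: every continuous operator `G : C(X; ℝ^dᵢ) → C(X; ℝ^dₒ)` can be approximated by the
architecture to any accuracy `ε`, uniformly on any compact set `K` of input functions and uniformly
on the domain, by a suitable choice of the channel width and of the weights. -/
def ConvArchitecture.IsUniversal {X E : Type*} [TopologicalSpace X] [AddCommGroup E]
    [MeasurableSpace E] {ι : X → E} {L : ℕ} (𝒜 : ConvArchitecture.{u} ι L) (σ : ℝ → ℝ) {m : ℕ}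
    (p : X → Fin m → ℝ) (dᵢ dₒ : ℕ) : Prop :=
  ∀ G : C(X, EuclideanSpace ℝ (Fin dᵢ)) → C(X, EuclideanSpace ℝ (Fin dₒ)), Continuous G →
    ∀ K : Set C(X, EuclideanSpace ℝ (Fin dᵢ)), IsCompact K →
      ∀ ε : ℝ, 0 < ε →
        ∃ (H : ℕ) (w : 𝒜.Weights dᵢ m dₒ H),
          ∀ u ∈ K, ∀ x : X, ‖G u x - w.operator σ p u x‖ ≤ ε

/-! Since `K × X` is compact, `(u, x) ↦ G u x` is a continuous function on a compact space, and
shallow networks are dense there as soon as their preactivations form a linear space that contains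
the constants and separates points (`span_comp_topologicalClosure_eq_top`). The preactivations used
are `α ⬝ᵥ p x + b + I (∑ i, uᵢ fᵢ) x`, where `I` is the iterated convolution. Injectivity of `p`
separates positions. Two inputs `u ≠ u'` are separated at every single `x`: if `I ((uᵢ - u'ᵢ) φ) x =
0` for all `φ`, then `k x y * (uᵢ - u'ᵢ) y = 0` almost everywhere, and since the kernel vanishes
nowhere, `uᵢ = u'ᵢ` (`exists_neurons_approx_operator`).

It remains to realize such a network. The lifting net approximates `p x` and the products `∑ i, uᵢ
fᵢ`. Each hidden layer uses groups of neurons to imitate the identity, so that up to a small error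
it acts linearly: it carries `p` along unchanged and convolves the other signals with `g ℓ`
(`exists_hiddenLayer_approx`, `exists_composeLayers_approx`). The projection net supplies the outer
neurons. Channel `0` carries no signal; the matrices `A ℓ` all fix its unit vector, so their product
is nonzero, as `FullFieldOfView` demands. -/

/-! ### Density of shallow networks over a linear space of preactivations. -/

open Filter Topology in
theorem hasDerivAt_continuousMap_of_pointwise {Z : Type*} [TopologicalSpace Z] [CompactSpace Z]
    {F F' : ℝ → C(Z, ℝ)} (hF' : Continuous F')
    (h : ∀ z a, HasDerivAt (fun s => F s z) (F' a z) a) (a : ℝ) : HasDerivAt F (F' a) a := by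
  -- Integrating pointwise writes `F` as a Bochner integral of the continuous curve `F'`, which
  -- upgrades pointwise to norm differentiability.
  have key : F = fun s => F 0 + ∫ t in (0 : ℝ)..s, F' t := by
    funext s
    ext z
    have hint : IntervalIntegrable F' volume 0 s := hF'.intervalIntegrable _ _
    have h1 : (∫ t in (0 : ℝ)..s, F' t) z = ∫ t in (0 : ℝ)..s, F' t z :=
      ((ContinuousMap.evalCLM ℝ z).intervalIntegral_comp_comm hint).symm
    have h2 : ∫ t in (0 : ℝ)..s, F' t z = F s z - F 0 z :=
      intervalIntegral.integral_eq_sub_of_hasDerivAt (fun t _ => h z t)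
        (((ContinuousMap.evalCLM ℝ z).continuous.comp hF').intervalIntegrable _ _)
    simp [h1, h2]
  rw [key]
  exact (intervalIntegral.integral_hasDerivAt_right (hF'.intervalIntegrable _ _)
    (hF'.stronglyMeasurableAtFilter _ _) hF'.continuousAt).const_add _

/-- A functional annihilating all `τ (a w + b)` with `τ` smooth kills the powers of `w`, up to the
derivatives of `τ`. -/
theorem iteratedDeriv_mul_functional_pow_eq_zero {Z : Type*} [TopologicalSpace Z] [CompactSpace Z]
    (Λ : C(Z, ℝ) →L[ℝ] ℝ) (w : C(Z, ℝ)) (τ : ℝ → ℝ) (hτ : ContDiff ℝ (⊤ : ℕ∞) τ)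
    (h : ∀ (a b : ℝ) (f : C(Z, ℝ)), (∀ z, f z = τ (a * w z + b)) → Λ f = 0) (k : ℕ) (b : ℝ) :
    iteratedDeriv k τ b * Λ (w ^ k) = 0 := by
  have hc : ∀ k, Continuous (iteratedDeriv k τ) := fun k =>
    hτ.continuous_iteratedDeriv k (by exact_mod_cast le_top)
  have hd : ∀ k x, HasDerivAt (iteratedDeriv k τ) (iteratedDeriv (k + 1) τ x) x := fun k x => by
    rw [iteratedDeriv_succ]
    exact (hτ.differentiable_iteratedDeriv k (by exact_mod_cast WithTop.coe_lt_top k) x).hasDerivAt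
  -- The `k`-th derivative of `τ (a w + b)` in `a`; at `a = 0` it equals `τ⁽ᵏ⁾(b) wᵏ`.
  let F : ℕ → ℝ → C(Z, ℝ) := fun k a =>
    ⟨fun z => w z ^ k * iteratedDeriv k τ (a * w z + b), by have := hc k; fun_prop⟩
  have hFc : ∀ k, Continuous (F k) := fun k =>
    ContinuousMap.continuous_of_continuous_uncurry _ (by
      have := hc k
      simp only [F, Function.uncurry_def, ContinuousMap.coe_mk]
      fun_prop)
  have hFd : ∀ k a, HasDerivAt (F k) (F (k + 1) a) a := fun k a => by
    refine hasDerivAt_continuousMap_of_pointwise (hFc (k + 1)) (fun z a => ?_) a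
    have h1 : HasDerivAt (fun s : ℝ => s * w z + b) (w z) a := by
      simpa using ((hasDerivAt_id a).mul_const (w z)).add_const b
    have h2 := ((hd k (a * w z + b)).comp a h1).const_mul (w z ^ k)
    refine h2.congr_deriv ?_
    simp only [F, ContinuousMap.coe_mk]
    ring
  have hΛ : ∀ k a, Λ (F k a) = 0 := by
    intro k
    induction k with
    | zero => intro a; exact h a b _ (fun z => by simp [F])
    | succ k ih =>
      intro a
      have h1 : HasDerivAt (fun s => Λ (F k s)) (Λ (F (k + 1) a)) a :=
        Λ.hasFDerivAt.comp_hasDerivAt a (hFd k a)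
      have h2 : (fun s => Λ (F k s)) = fun _ => 0 := funext ih
      rw [h2] at h1
      exact h1.unique (hasDerivAt_const a 0)
  have := hΛ k 0
  have h3 : F k 0 = iteratedDeriv k τ b • w ^ k := by
    ext z
    simp [F, mul_comm]
  rw [h3, map_smul] at this
  simpa using this

/-- The Lagrange remainder in Taylor's formula at `0` vanishes. The degree bound matters for the
passage to the limit below. -/
theorem exists_polynomial_of_iteratedDeriv_eq_zero (k : ℕ) (τ : ℝ → ℝ)
    (hτ : ContDiff ℝ (⊤ : ℕ∞) τ) (h : ∀ x, iteratedDeriv k τ x = 0) :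
    ∃ q : Polynomial ℝ, q.degree < k ∧ ∀ x, τ x = q.eval x := by
  cases k with
  | zero => exact ⟨0, by simp, by simpa using h⟩
  | succ n =>
    let q : Polynomial ℝ := ∑ i ∈ Finset.range (n + 1),
      Polynomial.C (iteratedDeriv i τ 0 / i.factorial) * Polynomial.X ^ i
    refine ⟨q, ?_, fun x => ?_⟩
    · refine (Polynomial.degree_sum_le _ _).trans_lt ?_
      rw [Finset.sup_lt_iff (by exact WithBot.bot_lt_coe _)]
      intro i hi
      refine (Polynomial.degree_C_mul_X_pow_le _ _).trans_lt ?_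
      exact_mod_cast Finset.mem_range.1 hi
    · have hq : q.eval x = ∑ i ∈ Finset.range (n + 1), iteratedDeriv i τ 0 / i.factorial * x ^ i := by
        simp [q, Polynomial.eval_finsetSum]
      rw [hq]
      rcases eq_or_ne 0 x with rfl | hx
      · rw [Finset.sum_eq_single 0] <;> simp +contextual
      · have hcd : ContDiff ℝ (n + 1 : ℕ) τ := hτ.of_le (by exact_mod_cast le_top)
        obtain ⟨y, -, hy⟩ := taylor_mean_remainder_lagrange_iteratedDeriv (n := n) hx
          (f := τ) (by exact_mod_cast hcd.contDiffOn)
        rw [h, zero_mul, zero_div, sub_eq_zero] at hy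
        rw [hy, taylor_within_apply]
        refine Finset.sum_congr rfl fun i hi => ?_
        have hu : UniqueDiffOn ℝ (Set.uIcc 0 x) := uniqueDiffOn_Icc (inf_lt_sup.2 hx)
        rw [iteratedDerivWithin_eq_iteratedDeriv hu
          ((hτ.of_le (by exact_mod_cast le_top)).contDiffAt) Set.left_mem_uIcc]
        simp [div_eq_inv_mul]
        ring

-- Polynomials of degree below `k` are recovered from their values at `0, …, k - 1` by one fixed
-- interpolation formula, and this formula survives pointwise limits.
open Filter Topology in
theorem exists_polynomial_of_tendsto {ι : Type*} {l : Filter ι} [l.NeBot] (k : ℕ) (τ : ι → ℝ → ℝ)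
    (σ : ℝ → ℝ) (hτ : ∀ i, ∃ q : Polynomial ℝ, q.degree < k ∧ ∀ x, τ i x = q.eval x)
    (h : ∀ x, Tendsto (fun i => τ i x) l (𝓝 (σ x))) :
    ∃ q : Polynomial ℝ, ∀ x, σ x = q.eval x := by
  have hinj : Set.InjOn (fun i : ℕ => (i : ℝ)) (Finset.range k) := Nat.cast_injective.injOn
  refine ⟨Lagrange.interpolate (Finset.range k) (fun i : ℕ => (i : ℝ)) fun i => σ i, fun x => ?_⟩
  refine tendsto_nhds_unique (h x) ?_
  have h1 : ∀ i, τ i x = ∑ j ∈ Finset.range k,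
      τ i j * (Lagrange.basis (Finset.range k) (fun i : ℕ => (i : ℝ)) j).eval x := fun i => by
    obtain ⟨q, hq, hqx⟩ := hτ i
    rw [hqx x]
    conv_lhs => rw [Lagrange.eq_interpolate (f := q) hinj (by simpa using hq)]
    simp [Lagrange.interpolate_apply, Polynomial.eval_finsetSum, hqx]
  simp only [h1, Lagrange.interpolate_apply, Polynomial.eval_finsetSum, Polynomial.eval_mul,
    Polynomial.eval_C]
  exact tendsto_finsetSum _ fun j _ => (h j).mul_const _

theorem Submodule.exists_functional_of_notMem_of_isClosed {E : Type*} [NormedAddCommGroup E]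
    [NormedSpace ℝ E] (V : Submodule ℝ E) (hV : IsClosed (V : Set E)) {x : E} (hx : x ∉ V) :
    ∃ Λ : E →L[ℝ] ℝ, (∀ v ∈ V, Λ v = 0) ∧ Λ x ≠ 0 := by
  obtain ⟨Λ, s, h1, h2⟩ := geometric_hahn_banach_closed_point V.convex hV (x := x) hx
  have h0 : ∀ v ∈ V, Λ v = 0 := by
    intro v hv
    by_contra hne
    -- If `Λ v ≠ 0`, rescaling `v` reaches the value `s`, although `Λ < s` on `V`.
    have := h1 _ (V.smul_mem (s / Λ v) hv)
    simp [hne] at this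
  have := h1 0 V.zero_mem
  rw [map_zero] at this
  exact ⟨Λ, h0, (this.trans h2).ne'⟩

open Filter Topology in
/-- Powers of a function `w` are limits of linear combinations of the functions `σ (a w + b)`. -/
theorem pow_mem_of_comp_affine_mem {Z : Type*} [TopologicalSpace Z] [CompactSpace Z]
    {σ : ℝ → ℝ} (hσ : Continuous σ) (hσ_poly : ¬ ∃ q : Polynomial ℝ, ∀ t, σ t = q.eval t)
    (V : Submodule ℝ C(Z, ℝ)) (hV : IsClosed (V : Set C(Z, ℝ))) (w : C(Z, ℝ))
    (hw : ∀ (a b : ℝ) (f : C(Z, ℝ)), (∀ z, f z = σ (a * w z + b)) → f ∈ V) (k : ℕ) :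
    w ^ k ∈ V := by
  -- A functional `Λ` that kills `V` but not `wᵏ` also kills the neurons of every mollification `τ
  -- n` of `σ`. Then the `k`-th derivative of each `τ n` is zero, so each is a polynomial of degree
  -- below `k`, and so is their limit `σ`.
  by_contra hk
  obtain ⟨Λ, hΛV, hΛ⟩ := V.exists_functional_of_notMem_of_isClosed hV hk
  refine hσ_poly ?_
  let φ : ℕ → ContDiffBump (0 : ℝ) := fun n =>
    ⟨1 / (n + 1) / 2, 1 / (n + 1), by positivity, half_lt_self (by positivity)⟩
  let τ : ℕ → ℝ → ℝ := fun n =>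
    convolution ((φ n).normed volume) σ (ContinuousLinearMap.lsmul ℝ ℝ) volume
  have hτ : ∀ n, ContDiff ℝ (⊤ : ℕ∞) (τ n) := fun n =>
    (φ n).hasCompactSupport_normed.contDiff_convolution_left _ (φ n).contDiff_normed
      hσ.locallyIntegrable
  refine exists_polynomial_of_tendsto (l := atTop) k τ σ (fun n => ?_) fun x => ?_
  · refine exists_polynomial_of_iteratedDeriv_eq_zero k (τ n) (hτ n) fun b => ?_
    refine (mul_eq_zero.1 (iteratedDeriv_mul_functional_pow_eq_zero Λ w (τ n) (hτ n) ?_ k b)).resolve_right hΛ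
    intro a b f hf
    have hcn : Continuous ((φ n).normed volume) := (φ n).continuous_normed
    let Φ : ℝ → C(Z, ℝ) := fun s => (φ n).normed volume s •
      ⟨fun z => σ (a * w z + b - s), by fun_prop⟩
    have hΦc : Continuous Φ := by
      refine hcn.smul (ContinuousMap.continuous_of_continuous_uncurry _ ?_)
      simp only [Function.uncurry_def, ContinuousMap.coe_mk]
      fun_prop
    have hΦi : Integrable Φ :=
      hΦc.integrable_of_hasCompactSupport ((φ n).hasCompactSupport_normed.smul_right)
    -- A mollified neuron is a `C(Z, ℝ)`-valued integral of translated neurons, so `Λ` passes under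
    -- the integral.
    have hfi : f = ∫ s, Φ s := by
      ext z
      rw [ContinuousMap.integral_apply hΦi, hf]
      simp [τ, convolution, Φ]
    rw [hfi, ← Λ.integral_comp_comm hΦi]
    refine integral_eq_zero_of_ae (Eventually.of_forall fun s => ?_)
    have h1 : Λ ⟨fun z => σ (a * w z + b - s), by fun_prop⟩ = 0 :=
      hΛV _ (hw a (b - s) _ fun z => by simp [add_sub_assoc])
    simp [Φ, map_smul, h1]
  · refine ContDiffBump.convolution_tendsto_right_of_continuous ?_ hσ x
    exact tendsto_one_div_add_atTop_nhds_zero_nat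

/-- Universal approximation by shallow networks with a continuous non-polynomial activation, for an
arbitrary linear space of preactivations that contains the constants and separates points. -/
theorem span_comp_topologicalClosure_eq_top {Z : Type*} [TopologicalSpace Z] [CompactSpace Z]
    (σ : C(ℝ, ℝ)) (hσ_poly : ¬ ∃ q : Polynomial ℝ, ∀ t, σ t = q.eval t)
    (W : Submodule ℝ C(Z, ℝ)) (h1 : 1 ∈ W) (hsep : ∀ x y, x ≠ y → ∃ w ∈ W, w x ≠ w y) :
    (Submodule.span ℝ ((fun w => σ.comp w) '' (W : Set C(Z, ℝ)))).topologicalClosure = ⊤ := by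
  set V := (Submodule.span ℝ ((fun w => σ.comp w) '' (W : Set C(Z, ℝ)))).topologicalClosure
  have hV : IsClosed (V : Set C(Z, ℝ)) := Submodule.isClosed_topologicalClosure _
  have hmem : ∀ w ∈ W, σ.comp w ∈ V := fun w hw =>
    Submodule.le_topologicalClosure _ (Submodule.subset_span ⟨w, hw, rfl⟩)
  have hpow : ∀ w ∈ W, ∀ k, w ^ k ∈ V := fun w hw k =>
    pow_mem_of_comp_affine_mem σ.continuous hσ_poly V hV w (fun a b f hf => by
      have : f = σ.comp (a • w + b • 1) := by ext z; simp [hf]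
      rw [this]
      exact hmem _ (W.add_mem (W.smul_mem _ hw) (W.smul_mem _ h1))) k
  have hexp : ∀ w ∈ W, NormedSpace.exp w ∈ V := fun w hw =>
    hV.mem_of_tendsto (NormedSpace.exp_series_hasSum_exp' (𝕂 := ℝ) w)
      (Filter.Eventually.of_forall fun s => V.sum_mem fun k _ => V.smul_mem _ (hpow w hw k))
  have hexp_apply : ∀ (w : C(Z, ℝ)) z, NormedSpace.exp w z = Real.exp (w z) := fun w z => by
    rw [Real.exp_eq_exp_ℝ]
    exact NormedSpace.map_exp (ContinuousMap.evalAlgHom ℝ ℝ z) (continuous_eval_const z) w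
  -- `V` need not be closed under products, but exponentials of `W` are, by `exp v * exp w = exp (v
  -- + w)`. Their span is thus an algebra inside `V`, to which Stone–Weierstrass applies.
  let M : Submonoid C(Z, ℝ) :=
    { carrier := NormedSpace.exp '' (W : Set C(Z, ℝ))
      one_mem' := ⟨0, W.zero_mem, NormedSpace.exp_zero⟩
      mul_mem' := by
        rintro _ _ ⟨v, hv, rfl⟩ ⟨w, hw, rfl⟩
        exact ⟨v + w, W.add_mem hv hw, NormedSpace.exp_add⟩ }
  have hsub : (Algebra.adjoin ℝ (M : Set C(Z, ℝ)) : Set C(Z, ℝ)) ⊆ V := by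
    have : (Algebra.adjoin ℝ (M : Set C(Z, ℝ))).toSubmodule ≤ V := by
      rw [Algebra.adjoin_eq_span, Submonoid.closure_eq, Submodule.span_le]
      rintro _ ⟨w, hw, rfl⟩
      exact hexp w hw
    exact this
  have hdense := ContinuousMap.subalgebra_topologicalClosure_eq_top_of_separatesPoints
    (Algebra.adjoin ℝ (M : Set C(Z, ℝ))) (by
      intro x y hxy
      obtain ⟨w, hw, hne⟩ := hsep x y hxy
      refine ⟨_, ⟨NormedSpace.exp w, Algebra.subset_adjoin ⟨w, hw, rfl⟩, rfl⟩, ?_⟩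
      simpa [hexp_apply] using hne)
  rw [eq_top_iff]
  intro f _
  have hf : f ∈ (Algebra.adjoin ℝ (M : Set C(Z, ℝ))).topologicalClosure := hdense ▸ trivial
  exact closure_minimal hsub hV hf

/-- Finitely many continuous functions are approximated by linear combinations of a common finite
set of neurons. -/
theorem exists_neurons_approx {Z : Type*} [TopologicalSpace Z] [CompactSpace Z]
    (σ : C(ℝ, ℝ)) (hσ_poly : ¬ ∃ q : Polynomial ℝ, ∀ t, σ t = q.eval t)
    (W : Submodule ℝ C(Z, ℝ)) (h1 : 1 ∈ W) (hsep : ∀ x y, x ≠ y → ∃ w ∈ W, w x ≠ w y)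
    {ρ : Type*} [Finite ρ] (t : ρ → C(Z, ℝ)) {ε : ℝ} (hε : 0 < ε) :
    ∃ (N : ℕ) (w : Fin N → W) (c : ρ → Fin N → ℝ),
      ∀ r z, |∑ j, c r j * σ ((w j : C(Z, ℝ)) z) - t r z| < ε := by
  classical
  have := Fintype.ofFinite ρ
  have hdense := span_comp_topologicalClosure_eq_top σ hσ_poly W h1 hsep
  have hex : ∀ r, ∃ a : W →₀ ℝ, ∀ z,
      |∑ w ∈ a.support, a w * σ ((w : C(Z, ℝ)) z) - t r z| < ε := by
    intro r
    have hmem : t r ∈ closure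
        (Submodule.span ℝ ((fun w => σ.comp w) '' (W : Set C(Z, ℝ))) : Set C(Z, ℝ)) := by
      rw [← Submodule.topologicalClosure_coe, hdense]; trivial
    obtain ⟨f, hf, hd⟩ := Metric.mem_closure_iff.1 hmem ε hε
    rw [Set.image_eq_range] at hf
    obtain ⟨a, rfl⟩ := (Finsupp.mem_span_range_iff_exists_finsupp).1 hf
    refine ⟨a, fun z => ?_⟩
    have := (ContinuousMap.dist_lt_iff hε).1 hd z
    rw [dist_comm, Real.dist_eq] at this
    simpa [Finsupp.sum, ContinuousMap.sum_apply] using this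
  choose a ha using hex
  -- The union of all supports; coefficients outside a given support are zero.
  let s : Finset W := Finset.univ.biUnion fun r => (a r).support
  let e := s.equivFin
  refine ⟨s.card, fun j => (e.symm j : W), fun r j => a r (e.symm j : W), fun r z => ?_⟩
  have h2 : ∑ j, a r (e.symm j : W) * σ (((e.symm j : W) : C(Z, ℝ)) z) =
      ∑ w ∈ (a r).support, a r w * σ ((w : C(Z, ℝ)) z) := by
    rw [e.symm.sum_comp (fun w : s => a r w * σ (((w : W) : C(Z, ℝ)) z)),
      Finset.sum_coe_sort s (fun w : W => a r w * σ ((w : C(Z, ℝ)) z))]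
    refine (Finset.sum_subset (Finset.subset_biUnion_of_mem (fun r => (a r).support)
      (Finset.mem_univ r)) fun w _ hw => ?_).symm
    rw [Finsupp.notMem_support_iff.1 hw, zero_mul]
  rw [h2]
  exact ha r z

/-! ### Convolution over the domain as a bounded operator. -/

theorem norm_extend_apply_le {X E : Type*} [TopologicalSpace X] [CompactSpace X] (ι : X → E) (f : C(X, ℝ)) (z : E) :
    ‖Function.extend ι f 0 z‖ ≤ ‖f‖ := by
  classical
  rw [Function.extend_def]
  split_ifs
  · exact f.norm_coe_le_norm _
  · simp

theorem SignedMeasure.isFiniteMeasure_variation {E : Type*} [MeasurableSpace E] (g : SignedMeasure E) :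
    IsFiniteMeasure g.variation := by
  rw [← SignedMeasure.totalVariation_eq_variation, SignedMeasure.totalVariation]
  infer_instance

theorem norm_domainConv_le {X E : Type*} [TopologicalSpace X] [CompactSpace X] [AddCommGroup E]
    [MeasurableSpace E] {ι : X → E} (g : SignedMeasure E) (f : C(X, ℝ)) (x : X) :
    ‖domainConv ι g f x‖ ≤
      ‖(ContinuousLinearMap.lsmul ℝ ℝ : ℝ →L[ℝ] ℝ →L[ℝ] ℝ).flip‖ *
        g.variation.real Set.univ * ‖f‖ := by
  have := SignedMeasure.isFiniteMeasure_variation g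
  refine (VectorMeasure.norm_integral_le_of_norm_le_const
    (Filter.Eventually.of_forall fun z => norm_extend_apply_le ι f _)).trans_eq ?_
  ring

theorem domainConv_smul_measure {X E : Type*} [AddCommGroup E] [MeasurableSpace E] {ι : X → E} (a : ℝ)
    (g : SignedMeasure E) (f : X → ℝ) (x : X) :
    domainConv ι (a • g) f x = a * domainConv ι g f x := by
  simp [domainConv]

section DomainConv

variable {X E : Type*} [TopologicalSpace X] [CompactSpace X] [MeasurableSpace X]
  [OpensMeasurableSpace X] [AddCommGroup E] [MeasurableSpace E] [MeasurableSub₂ E] {ι : X → E}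

theorem integrable_extend_sub (hι : MeasurableEmbedding ι) (g : SignedMeasure E) (f : C(X, ℝ))
    (x : X) : g.Integrable fun z => Function.extend ι f 0 (ι x - z) := by
  have := SignedMeasure.isFiniteMeasure_variation g
  refine Integrable.of_bound (C := ‖f‖) ?_ (Filter.Eventually.of_forall fun z =>
    norm_extend_apply_le ι f _)
  exact ((hι.measurable_extend f.continuous.measurable measurable_const).comp
    (measurable_const.sub measurable_id)).aestronglyMeasurable

/-- Convolution over the domain as a continuous linear operator. -/
noncomputable def domainConvCLM (hι : MeasurableEmbedding ι) (g : SignedMeasure E)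
    (hg : ∀ f : C(X, ℝ), Continuous (domainConv ι g f)) : C(X, ℝ) →L[ℝ] C(X, ℝ) :=
  LinearMap.mkContinuous
    { toFun := fun f => ⟨domainConv ι g f, hg f⟩
      map_add' := fun f₁ f₂ => by
        ext x
        have : Function.extend ι (⇑(f₁ + f₂)) 0 =
            Function.extend ι f₁ 0 + Function.extend ι f₂ 0 := by
          rw [← Function.extend_add, add_zero]; rfl
        simp only [domainConv, this, ContinuousMap.coe_mk, ContinuousMap.add_apply, Pi.add_apply]
        exact VectorMeasure.integral_fun_add (integrable_extend_sub hι g f₁ x)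
          (integrable_extend_sub hι g f₂ x)
      map_smul' := fun a f => by
        ext x
        have : Function.extend ι (⇑(a • f)) 0 = a • Function.extend ι f 0 := by
          rw [← Function.extend_smul, smul_zero]; rfl
        simp only [domainConv, this, ContinuousMap.coe_mk, ContinuousMap.smul_apply, Pi.smul_apply]
        exact VectorMeasure.integral_fun_smul _ _ a _ }
    (‖(ContinuousLinearMap.lsmul ℝ ℝ : ℝ →L[ℝ] ℝ →L[ℝ] ℝ).flip‖ * g.variation.real Set.univ)
    fun f => by
      rw [ContinuousMap.norm_le _ (by positivity)]
      exact norm_domainConv_le g f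

theorem domainConvCLM_apply (hι : MeasurableEmbedding ι) (g : SignedMeasure E)
    (hg : ∀ f : C(X, ℝ), Continuous (domainConv ι g f)) (f : C(X, ℝ)) (x : X) :
    domainConvCLM hι g hg f x = domainConv ι g f x := rfl

end DomainConv

/-! ### Placing neurons in channels, and imitating the identity. -/

theorem sum_extend_mul {q H : Type*} [Fintype q] [Fintype H] {e : q → H}
    (he : Function.Injective e) (c : q → ℝ) (F : H → ℝ) :
    ∑ i, Function.extend e c 0 i * F i = ∑ j, c j * F (e j) := by
  refine (Finset.sum_of_injOn e he.injOn (by simp) (fun i _ hi => ?_) fun j _ => ?_).symm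
  · rw [Function.extend_apply' _ _ _ (by simpa using hi)]
    simp
  · rw [he.extend_apply]

/-- Channel `0` is kept free of signals. -/
theorem exists_injective_ne_zero (q : Type*) [Fintype q] {n : ℕ} (h : Fintype.card q ≤ n) :
    ∃ e : q → Fin (n + 1), Function.Injective e ∧ ∀ j, e j ≠ 0 := by
  obtain ⟨f⟩ := Function.Embedding.nonempty_of_card_le (α := q) (β := Fin n) (by simpa using h)
  exact ⟨fun j => (f j).succ, fun i j hij => f.injective (Fin.succ_injective _ hij),
    fun j => Fin.succ_ne_zero _⟩

theorem exists_neurons_approx_of_linearMap {Z : Type*} [TopologicalSpace Z] [CompactSpace Z]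
    (σ : C(ℝ, ℝ)) (hσ_poly : ¬ ∃ q : Polynomial ℝ, ∀ t, σ t = q.eval t)
    {P : Type*} [AddCommGroup P] [Module ℝ P]
    (Φ : P →ₗ[ℝ] C(Z, ℝ)) (h1 : ∃ a, Φ a = 1) (hsep : ∀ x y, x ≠ y → ∃ a, Φ a x ≠ Φ a y)
    {ρ : Type*} [Finite ρ] (t : ρ → C(Z, ℝ)) {ε : ℝ} (hε : 0 < ε) :
    ∃ (N : ℕ) (a : Fin N → P) (c : ρ → Fin N → ℝ),
      ∀ r z, |∑ j, c r j * σ (Φ (a j) z) - t r z| < ε := by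
  obtain ⟨N, w, c, h⟩ := exists_neurons_approx σ hσ_poly (LinearMap.range Φ) h1
    (fun x y hxy => by
      obtain ⟨a, ha⟩ := hsep x y hxy
      exact ⟨_, ⟨a, rfl⟩, ha⟩) t hε
  choose a ha using fun j => (w j).2
  exact ⟨N, a, c, fun r z => by simpa only [ha] using h r z⟩

/-- Used to undo the activation at the end of each hidden layer. -/
theorem exists_neurons_approx_id (σ : C(ℝ, ℝ))
    (hσ_poly : ¬ ∃ q : Polynomial ℝ, ∀ t, σ t = q.eval t) (R : ℝ) {ε : ℝ} (hε : 0 < ε) :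
    ∃ (N : ℕ) (a b c : Fin N → ℝ), ∀ s, |s| ≤ R → |∑ j, c j * σ (a j * s + b j) - s| < ε := by
  let Φ : ℝ × ℝ →ₗ[ℝ] C(Set.Icc (-R) R, ℝ) :=
    { toFun := fun a => ⟨fun z => a.1 * z + a.2, by fun_prop⟩
      map_add' := fun a b => by ext z; simp; ring
      map_smul' := fun a b => by ext z; simp; ring }
  obtain ⟨N, a, c, h⟩ := exists_neurons_approx_of_linearMap σ hσ_poly Φ
    ⟨(0, 1), by ext z; simp [Φ]⟩
    (fun x y hxy => ⟨(1, 0), by simpa [Φ, Subtype.ext_iff] using hxy⟩)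
    (fun _ : Unit => ⟨fun z => (z : ℝ), continuous_subtype_val⟩) hε
  exact ⟨N, fun j => (a j).1, fun j => (a j).2, c (), fun s hs => h () ⟨s, abs_le.1 hs⟩⟩

/-! ### A single hidden layer as an approximate linear operator. -/

section Layers

variable {X E : Type*} [TopologicalSpace X] [CompactSpace X] [MeasurableSpace X]
  [OpensMeasurableSpace X] [AddCommGroup E] [MeasurableSpace E] [MeasurableSub₂ E] {ι : X → E}

theorem sum_domainConv_smul (hι : MeasurableEmbedding ι) (g : SignedMeasure E)
    (hg : ∀ f : C(X, ℝ), Continuous (domainConv ι g f)) {q : Type*} [Fintype q] (a : q → ℝ)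
    (v : q → C(X, ℝ)) (x : X) :
    ∑ j, domainConv ι (a j • g) (v j) x = domainConvCLM hι g hg (∑ j, a j • v j) x := by
  simp only [map_sum, map_smul, ContinuousMap.sum_apply, ContinuousMap.smul_apply, smul_eq_mul,
    domainConvCLM_apply, domainConv_smul_measure]

/-- One hidden layer can turn readouts close to `t r` into readouts close to
`w r * t r + c r * (g * t r)`.  Channel `0` is never read out, and the kernel matrix has the first
unit vector as its first column. -/
theorem exists_hiddenLayer_approx (σ : C(ℝ, ℝ))
    (hσ_poly : ¬ ∃ q : Polynomial ℝ, ∀ t, σ t = q.eval t) (hι : MeasurableEmbedding ι)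
    (g : SignedMeasure E) (hg : ∀ f : C(X, ℝ), Continuous (domainConv ι g f))
    {U ρ : Type*} [Fintype ρ] (w c : ρ → ℝ) (t : ρ → U → C(X, ℝ))
    (ht : ∃ R, ∀ r u, ‖t r u‖ ≤ R) {ε : ℝ} (hε : 0 < ε) :
    ∃ δ > 0, ∃ N, ∀ n ≥ N, ∀ (M : Matrix ρ (Fin (n + 1)) ℝ) (v : U → X → Fin (n + 1) → ℝ),
      (∀ r, M r 0 = 0) → (∀ u i, Continuous fun x => v u x i) →
      (∀ u x r, |M.mulVec (v u x) r - t r u x| ≤ δ) →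
      ∃ (W A : Matrix (Fin (n + 1)) (Fin (n + 1)) ℝ) (b : Fin (n + 1) → ℝ)
        (M' : Matrix ρ (Fin (n + 1)) ℝ),
        A.mulVec (Pi.single 0 1) = Pi.single 0 1 ∧ (∀ r, M' r 0 = 0) ∧
        (∀ u i, Continuous fun x => hiddenLayer ι σ W b (fun i j => A i j • g) (v u) x i) ∧
        ∀ u x r, |M'.mulVec (hiddenLayer ι σ W b (fun i j => A i j • g) (v u) x) r -
          (w r * t r u x + c r * domainConvCLM hι g hg (t r u) x)| ≤ ε := by
  classical
  set T := domainConvCLM hι g hg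
  obtain ⟨R, hR⟩ := ht
  obtain ⟨B, hB0, hB⟩ : ∃ B, 0 ≤ B ∧ ∀ r, |w r| + |c r| * ‖T‖ ≤ B :=
    ⟨∑ r, (|w r| + |c r| * ‖T‖), by positivity, fun r =>
      Finset.single_le_sum (f := fun r => |w r| + |c r| * ‖T‖) (fun _ _ => by positivity)
        (Finset.mem_univ r)⟩
  have hbound : ∀ r (f : C(X, ℝ)) x, |w r * f x + c r * T f x| ≤ B * ‖f‖ := by
    intro r f x
    have h1 : |f x| ≤ ‖f‖ := f.norm_coe_le_norm x
    have h2 : |T f x| ≤ ‖T‖ * ‖f‖ := ((T f).norm_coe_le_norm x).trans (T.le_opNorm f)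
    calc |w r * f x + c r * T f x| ≤ |w r| * |f x| + |c r| * |T f x| := by
          simpa only [abs_mul] using abs_add_le (w r * f x) (c r * T f x)
      _ ≤ |w r| * ‖f‖ + |c r| * (‖T‖ * ‖f‖) := by gcongr
      _ = (|w r| + |c r| * ‖T‖) * ‖f‖ := by ring
      _ ≤ B * ‖f‖ := by gcongr; exact hB r
  -- Exact signals are bounded by `B * R`; the extra `1` leaves room for the input error `η ≤ 1`.
  -- The other half of `ε` is spent on that error.
  obtain ⟨N₀, a, b, γ, hid⟩ := exists_neurons_approx_id σ hσ_poly (B * R + 1) (half_pos hε)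
  set η := min 1 (ε / 2)
  have hη : 0 < η := lt_min one_pos (half_pos hε)
  refine ⟨η / (B + 1), by positivity, Fintype.card (ρ × Fin N₀), fun n hn M v hM hv happ => ?_⟩
  obtain ⟨e, he, he0⟩ := exists_injective_ne_zero (ρ × Fin N₀) hn
  have hext0 : ∀ {α : Type} [Zero α] (f : ρ × Fin N₀ → α), Function.extend e f 0 0 = 0 :=
    fun f => Function.extend_apply' _ _ _ (by rintro ⟨j, hj⟩; exact he0 j hj)
  let vc : U → Fin (n + 1) → C(X, ℝ) := fun u i => ⟨fun x => v u x i, hv u i⟩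
  let y : ρ → U → C(X, ℝ) := fun r u => ∑ k, M r k • vc u k
  have hy : ∀ r u x, y r u x = M.mulVec (v u x) r := fun r u x => by
    simp [y, vc, Matrix.mulVec, dotProduct, ContinuousMap.sum_apply]
  have hyt : ∀ r u, ‖y r u - t r u‖ ≤ η / (B + 1) := fun r u => by
    rw [ContinuousMap.norm_le _ (by positivity)]
    intro x
    rw [ContinuousMap.sub_apply, hy]
    exact happ u x r
  -- Channel `e (r, j)` computes neuron `j` of the approximate identity at the signal `w r * y r + c
  -- r * T (y r)`, so its rows are multiples of the readout row `M r`.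
  let W : Matrix (Fin (n + 1)) (Fin (n + 1)) ℝ :=
    Function.extend e (fun q => (a q.2 * w q.1) • M q.1) 0
  -- Row `0` is the unit vector, and the other rows vanish in column `0` because `M r 0 = 0`; hence
  -- `A` fixes the first unit vector.
  let A : Matrix (Fin (n + 1)) (Fin (n + 1)) ℝ :=
    fun i => if i = 0 then Pi.single 0 1 else Function.extend e (fun q => (a q.2 * c q.1) • M q.1) 0 i
  have hA0 : A 0 = Pi.single 0 1 := if_pos rfl
  have hAe : ∀ q, A (e q) = (a q.2 * c q.1) • M q.1 := fun q =>
    (if_neg (he0 q)).trans (he.extend_apply _ _ q)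
  let M' : Matrix ρ (Fin (n + 1)) ℝ :=
    fun r => Function.extend e (fun q => if q.1 = r then γ q.2 else 0) 0
  have hconv : ∀ u x i, ∑ j, domainConv ι (A i j • g) (fun y => v u y j) x =
      T (∑ j, A i j • vc u j) x := fun u x i => sum_domainConv_smul hι g hg (A i) (vc u) x
  refine ⟨W, A, Function.extend e (fun q => b q.2) 0, M', ?_, fun r => hext0 _, fun u i => ?_,
    fun u x r => ?_⟩
  · ext i
    rw [Matrix.mulVec_single_one, Matrix.col_apply]
    by_cases hi : i = 0
    · subst hi
      rw [hA0]
    · rw [Pi.single_eq_of_ne hi]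
      by_cases hq : ∃ q, e q = i
      · obtain ⟨q, rfl⟩ := hq
        rw [hAe, Pi.smul_apply, hM, smul_zero]
      · have : A i = 0 := (if_neg hi).trans (Function.extend_apply' _ _ _ hq)
        rw [this, Pi.zero_apply]
  · simp only [hiddenLayer, hconv, Matrix.mulVec, dotProduct]
    have := hv u
    fun_prop
  · have hpre : ∀ q : ρ × Fin N₀,
        hiddenLayer ι σ W (Function.extend e (fun q => b q.2) 0) (fun i j => A i j • g) (v u) x (e q)
          = σ (a q.2 * (w q.1 * y q.1 u x + c q.1 * T (y q.1 u) x) + b q.2) := by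
      intro q
      have h1 : W.mulVec (v u x) (e q) = a q.2 * (w q.1 * y q.1 u x) := by
        rw [hy]
        simp only [W, Matrix.mulVec, he.extend_apply, smul_dotProduct, smul_eq_mul, mul_assoc]
      have h2 : ∑ j, A (e q) j • vc u j = (a q.2 * c q.1) • y q.1 u := by
        simp only [hAe, y, Finset.smul_sum, Pi.smul_apply, smul_smul,
          smul_eq_mul]
      simp only [hiddenLayer, hconv, h1, h2, he.extend_apply, map_smul, ContinuousMap.smul_apply,
        smul_eq_mul]
      congr 1
      ring
    have hsum : M'.mulVec (hiddenLayer ι σ W (Function.extend e (fun q => b q.2) 0)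
        (fun i j => A i j • g) (v u) x) r =
        ∑ j, γ j * σ (a j * (w r * y r u x + c r * T (y r u) x) + b j) := by
      simp only [Matrix.mulVec, dotProduct, M', sum_extend_mul he, hpre]
      rw [Fintype.sum_prod_type, Finset.sum_eq_single r] <;> simp +contextual
    rw [hsum]
    set s := w r * y r u x + c r * T (y r u) x
    set s₀ := w r * t r u x + c r * T (t r u) x with hs₀
    have hss : |s - s₀| ≤ η := by
      have h1 : s - s₀ = w r * (y r u - t r u) x + c r * T (y r u - t r u) x := by
        simp only [s, s₀, map_sub, ContinuousMap.sub_apply]; ring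
      rw [h1]
      calc _ ≤ B * (η / (B + 1)) := (hbound r _ x).trans (by gcongr; exact hyt r u)
        _ ≤ (B + 1) * (η / (B + 1)) := by gcongr; linarith
        _ = η := by field_simp
    have hs0 : |s₀| ≤ B * R := (hbound r _ x).trans (by gcongr; exact hR r u)
    have hs : |s| ≤ B * R + 1 := by
      have := abs_add_le (s - s₀) s₀
      rw [sub_add_cancel] at this
      linarith [min_le_left 1 (ε / 2)]
    have h3 := hid s hs
    have h4 := abs_sub_le (∑ j, γ j * σ (a j * s + b j)) s s₀
    linarith [min_le_right 1 (ε / 2)]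

end Layers

/-! ### Stacks of hidden layers. -/

/-- The linear operator `(w + c T_L) ⋯ (w + c T_1)`. -/
noncomputable def layerOperator {F : Type*} [NormedAddCommGroup F] [NormedSpace ℝ F] {L : ℕ}
    (T : Fin L → F →L[ℝ] F) (w c : ℝ) : F →L[ℝ] F :=
  composeLayers L (fun ℓ S => (w • ContinuousLinearMap.id ℝ F + c • T ℓ).comp S)
    (ContinuousLinearMap.id ℝ F)

theorem layerOperator_one_zero {F : Type*} [NormedAddCommGroup F] [NormedSpace ℝ F] {L : ℕ}
    (T : Fin L → F →L[ℝ] F) (f : F) : layerOperator T 1 0 f = f := by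
  induction L with
  | zero => rfl
  | succ L ih => simpa [layerOperator, composeLayers] using ih fun ℓ => T ℓ.castSucc

/-- A common fixed vector is fixed by the product. -/
theorem layerProduct_ne_zero {H L : ℕ} (A : Fin L → Matrix (Fin H) (Fin H) ℝ) {x : Fin H → ℝ}
    (hx : x ≠ 0) (hA : ∀ ℓ, (A ℓ).mulVec x = x) : layerProduct A ≠ 0 := by
  have h : (layerProduct A).mulVec x = x := by
    induction L with
    | zero => simp [layerProduct, composeLayers]
    | succ L ih =>
      have := ih (fun ℓ => A ℓ.castSucc) fun ℓ => hA _
      simp only [layerProduct, composeLayers] at this ⊢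
      rw [← Matrix.mulVec_mulVec, this, hA]
  intro h0
  rw [h0, Matrix.zero_mulVec] at h
  exact hx h.symm

section LayerStack

variable {X E : Type*} [TopologicalSpace X] [CompactSpace X] [MeasurableSpace X]
  [OpensMeasurableSpace X] [AddCommGroup E] [MeasurableSpace E] [MeasurableSub₂ E] {ι : X → E}

theorem layerOperator_domainConvCLM_apply (hι : MeasurableEmbedding ι) {L : ℕ}
    (g : Fin L → SignedMeasure E) (hg : ∀ ℓ, ∀ f : C(X, ℝ), Continuous (domainConv ι (g ℓ) f))
    (f : C(X, ℝ)) :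
    ⇑(layerOperator (fun ℓ => domainConvCLM hι (g ℓ) (hg ℓ)) 0 1 f) =
      composeLayers L (fun ℓ => domainConv ι (g ℓ)) f := by
  induction L with
  | zero => rfl
  | succ L ih =>
    have := ih (fun ℓ => g ℓ.castSucc) fun ℓ => hg ℓ.castSucc
    simp only [layerOperator, composeLayers] at this ⊢
    rw [← this]
    simp [domainConvCLM]

/-- A stack of hidden layers can turn readouts close to `t r` into readouts close to the result of
applying `w r + c r g_ℓ *` for all layers `ℓ`. -/
theorem exists_composeLayers_approx (σ : C(ℝ, ℝ))
    (hσ_poly : ¬ ∃ q : Polynomial ℝ, ∀ t, σ t = q.eval t) (hι : MeasurableEmbedding ι)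
    {U ρ : Type*} [Fintype ρ] (w c : ρ → ℝ) (L : ℕ) :
    ∀ (g : Fin L → SignedMeasure E) (hg : ∀ ℓ, ∀ f : C(X, ℝ), Continuous (domainConv ι (g ℓ) f))
    (t : ρ → U → C(X, ℝ)) (_ : ∃ R, ∀ r u, ‖t r u‖ ≤ R) (ε : ℝ) (_ : 0 < ε),
    ∃ δ > 0, ∃ N, ∀ n ≥ N, ∀ (M : Matrix ρ (Fin (n + 1)) ℝ) (v : U → X → Fin (n + 1) → ℝ),
      (∀ r, M r 0 = 0) → (∀ u i, Continuous fun x => v u x i) →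
      (∀ u x r, |M.mulVec (v u x) r - t r u x| ≤ δ) →
      ∃ (W A : Fin L → Matrix (Fin (n + 1)) (Fin (n + 1)) ℝ) (b : Fin L → Fin (n + 1) → ℝ)
        (M' : Matrix ρ (Fin (n + 1)) ℝ),
        (∀ ℓ, (A ℓ).mulVec (Pi.single 0 1) = Pi.single 0 1) ∧ (∀ r, M' r 0 = 0) ∧
        (∀ u i, Continuous fun x => composeLayers L
          (fun ℓ => hiddenLayer ι σ (W ℓ) (b ℓ) (fun i j => A ℓ i j • g ℓ)) (v u) x i) ∧
        ∀ u x r, |M'.mulVec (composeLayers L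
          (fun ℓ => hiddenLayer ι σ (W ℓ) (b ℓ) (fun i j => A ℓ i j • g ℓ)) (v u) x) r -
          layerOperator (fun ℓ => domainConvCLM hι (g ℓ) (hg ℓ)) (w r) (c r) (t r u) x| ≤ ε := by
  induction L with
  | zero =>
    intro g hg t ht ε hε
    exact ⟨ε, hε, 0, fun n _ M v hM hv happ => ⟨Fin.elim0, Fin.elim0, Fin.elim0, M,
      fun ℓ => ℓ.elim0, hM, hv, happ⟩⟩
  | succ L ih =>
    intro g hg t ht ε hε
    set T := fun ℓ => domainConvCLM hι (g ℓ) (hg ℓ) with hT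
    let t' : ρ → U → C(X, ℝ) := fun r u =>
      layerOperator (fun ℓ : Fin L => T ℓ.castSucc) (w r) (c r) (t r u)
    have ht' : ∃ R, ∀ r u, ‖t' r u‖ ≤ R := by
      obtain ⟨R, hR⟩ := ht
      exact ⟨∑ r, ‖layerOperator (fun ℓ : Fin L => T ℓ.castSucc) (w r) (c r)‖ * |R|, fun r u =>
        (ContinuousLinearMap.le_opNorm _ _).trans <|
          (mul_le_mul_of_nonneg_left ((hR r u).trans (le_abs_self R)) (norm_nonneg _)).trans <|
          Finset.single_le_sum (f := fun r =>
            ‖layerOperator (fun ℓ : Fin L => T ℓ.castSucc) (w r) (c r)‖ * |R|)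
            (fun _ _ => by positivity) (Finset.mem_univ r)⟩
    -- Tolerances are chosen from the last layer backwards: what it tolerates is the accuracy
    -- required of the layers before it.
    obtain ⟨δ', hδ', N', h'⟩ := exists_hiddenLayer_approx σ hσ_poly hι (g (Fin.last L))
      (hg (Fin.last L)) w c t' ht' hε
    obtain ⟨δ, hδ, N, h⟩ := ih (fun ℓ => g ℓ.castSucc) (fun ℓ => hg ℓ.castSucc) t ht δ' hδ'
    refine ⟨δ, hδ, max N N', fun n hn M v hM hv happ => ?_⟩
    obtain ⟨W, A, b, M₁, hA, hM₁, hv₁, happ₁⟩ := h n (le_of_max_le_left hn) M v hM hv happ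
    obtain ⟨W', A', b', M₂, hA', hM₂, hv₂, happ₂⟩ :=
      h' n (le_of_max_le_right hn) M₁ _ hM₁ hv₁ happ₁
    refine ⟨Fin.snoc W W', Fin.snoc A A', Fin.snoc b b', M₂, fun ℓ => ?_, hM₂, ?_, ?_⟩
    · refine Fin.lastCases ?_ (fun ℓ => ?_) ℓ
      · simpa using hA'
      · simpa using hA ℓ
    · simpa [composeLayers] using hv₂
    · simpa [composeLayers, layerOperator, t'] using happ₂

end LayerStack

/-! ### Lifting and projection networks. -/

theorem exists_shallowNet_lift (σ : C(ℝ, ℝ))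
    (hσ_poly : ¬ ∃ q : Polynomial ℝ, ∀ t, σ t = q.eval t) {X : Type*} [TopologicalSpace X]
    [CompactSpace X] {m dᵢ : ℕ} {p : X → Fin m → ℝ} (hp : Continuous p)
    (hp_inj : Function.Injective p) {ρ : Type*} [Fintype ρ]
    (h : ρ → C(EuclideanSpace ℝ (Fin dᵢ) × X, ℝ)) (R : ℝ) {ε : ℝ} (hε : 0 < ε) :
    ∃ N, ∀ n ≥ N, ∃ (net : ShallowNet (Fin dᵢ ⊕ Fin m) (Fin (n + 1)) (Fin (n + 1)))
      (M : Matrix ρ (Fin (n + 1)) ℝ), (∀ r, M r 0 = 0) ∧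
      ∀ (ξ : EuclideanSpace ℝ (Fin dᵢ)) (x : X) (r : ρ), ‖ξ‖ ≤ R →
        |M.mulVec (net.eval σ (Sum.elim (fun i => ξ i) (p x))) r - h r (ξ, x)| ≤ ε := by
  classical
  set B := Metric.closedBall (0 : EuclideanSpace ℝ (Fin dᵢ)) R
  let feat : B × X → Fin dᵢ ⊕ Fin m → ℝ := fun z => 
    Sum.elim (fun i => (z.1 : EuclideanSpace ℝ (Fin dᵢ)) i) (p z.2)
  have hfeat : Continuous feat := by
    refine continuous_pi fun s => ?_
    rcases s with i | i
    · simp only [feat, Sum.elim_inl]; fun_prop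
    · simp only [feat, Sum.elim_inr]; fun_prop
  let Φ : (Fin dᵢ ⊕ Fin m → ℝ) × ℝ →ₗ[ℝ] C(B × X, ℝ) :=
    { toFun := fun a => ⟨fun z => a.1 ⬝ᵥ feat z + a.2, by unfold dotProduct; fun_prop⟩
      map_add' := fun a b => by ext z; simp [add_dotProduct]; ring
      map_smul' := fun a b => by ext z; simp [smul_dotProduct]; ring }
  have hsep : ∀ x y : B × X, x ≠ y → ∃ a, Φ a x ≠ Φ a y := by
    intro x y hxy
    by_contra! hcon
    have hs : ∀ s, feat x s = feat y s := fun s => by simpa [Φ] using hcon (Pi.single s 1, 0)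
    refine hxy (Prod.ext (Subtype.ext ?_) (hp_inj (funext fun i => hs (Sum.inr i))))
    ext i
    exact hs (Sum.inl i)
  obtain ⟨N, a, c, hN⟩ := exists_neurons_approx_of_linearMap σ hσ_poly Φ
    ⟨(0, 1), by ext z; simp [Φ]⟩ hsep
    (fun r => (h r).comp ⟨fun z : B × X => ((z.1 : EuclideanSpace ℝ (Fin dᵢ)), z.2), by fun_prop⟩) hε
  refine ⟨max N (Fintype.card ρ), fun n hn => ?_⟩
  obtain ⟨e, he, -⟩ := exists_injective_ne_zero (Fin N) (n := n) (by simpa using le_of_max_le_left hn)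
  obtain ⟨e', he', he'0⟩ := exists_injective_ne_zero ρ (le_of_max_le_right hn)
  -- Output channel `e' r` approximates `h r`, and `M` merely selects it.
  refine ⟨⟨Function.extend e (fun j => (a j).1) 0, Function.extend e (fun j => (a j).2) 0,
    Function.extend e' (fun r => Function.extend e (c r) 0) 0, 0⟩, fun r => Pi.single (e' r) 1,
    fun r => Pi.single_eq_of_ne (he'0 r).symm _, fun ξ x r hξ => ?_⟩
  have hz := hN r (⟨ξ, by simpa [B] using hξ⟩, x)
  refine le_trans (le_of_eq ?_) hz.le
  congr 1
  simp only [Matrix.mulVec, single_one_dotProduct, ShallowNet.eval, add_zero,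
    he'.extend_apply]
  rw [dotProduct, sum_extend_mul he]
  simp only [he.extend_apply]
  rfl

theorem ShallowNet.continuous_eval {a h c : Type} [Fintype a] [Fintype h] (N : ShallowNet a h c)
    (σ : C(ℝ, ℝ)) : Continuous (N.eval σ) := by
  unfold ShallowNet.eval Matrix.mulVec dotProduct
  fun_prop

/-- Padding of the hidden layer of a shallow network to a larger width. -/
theorem exists_shallowNet_proj (σ : ℝ → ℝ) {N n dₒ : ℕ} (hN : N ≤ n)
    (A : Fin N → Fin (n + 1) → ℝ) (b : Fin N → ℝ) (C : Fin dₒ → Fin N → ℝ) :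
    ∃ net : ShallowNet (Fin (n + 1)) (Fin (n + 1)) (Fin dₒ), ∀ v r,
      net.eval σ v r = ∑ j, C r j * σ (A j ⬝ᵥ v + b j) := by
  obtain ⟨e, he, -⟩ := exists_injective_ne_zero (Fin N) (n := n) (by simpa using hN)
  refine ⟨⟨Function.extend e A 0, Function.extend e b 0, fun r => Function.extend e (C r) 0, 0⟩,
    fun v r => ?_⟩
  simp only [Matrix.mulVec, ShallowNet.eval, Pi.add_apply, Pi.zero_apply, add_zero]
  rw [dotProduct, sum_extend_mul he]
  simp only [he.extend_apply]

theorem EuclideanSpace.norm_le_sum_abs {ι : Type*} [Fintype ι] (x : EuclideanSpace ℝ ι) :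
    ‖x‖ ≤ ∑ i, |x i| := by
  rw [← abs_of_nonneg (norm_nonneg x), ← abs_of_nonneg (Finset.sum_nonneg fun i _ => abs_nonneg (x i)),
    ← sq_le_sq, EuclideanSpace.norm_sq_eq]
  exact Finset.sum_sq_le_sq_sum_of_nonneg fun i _ => abs_nonneg _

/-! ### Separation of points by a nowhere vanishing kernel. -/

-- Thickened indicators are continuous and converge to the indicator of a closed set, so by
-- dominated convergence `h` has zero integral over every closed set.
open Filter Topology in
theorem ae_eq_zero_of_forall_integral_continuous_mul_eq_zero {X : Type*} [PseudoEMetricSpace X]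
    [MeasurableSpace X] [BorelSpace X] {ν : Measure X} {h : X → ℝ} (hh : Integrable h ν)
    (h0 : ∀ φ : C(X, ℝ), ∫ y, φ y * h y ∂ν = 0) : h =ᵐ[ν] 0 := by
  refine ae_eq_zero_of_forall_setIntegral_isClosed_eq_zero hh fun s hs => ?_
  have hδ : ∀ n : ℕ, 0 < 1 / ((n : ℝ) + 1) := fun n => by positivity
  let φ : ℕ → C(X, ℝ) := fun n =>
    ⟨fun y => ((thickenedIndicator (hδ n) s y : NNReal) : ℝ), by fun_prop⟩
  have hlim : Tendsto (fun n => ∫ y, φ n y * h y ∂ν) atTop (𝓝 (∫ y, s.indicator h y ∂ν)) := by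
    refine tendsto_integral_of_dominated_convergence (fun y => ‖h y‖)
      (fun n => (φ n).continuous.aestronglyMeasurable.mul hh.aestronglyMeasurable) hh.norm
      (fun n => Eventually.of_forall fun y => ?_) (Eventually.of_forall fun y => ?_)
    · rw [norm_mul]
      refine mul_le_of_le_one_left (norm_nonneg _) ?_
      simpa [φ] using thickenedIndicator_le_one (hδ n) s y
    · have h1 := tendsto_pi_nhds.1 (thickenedIndicator_tendsto_indicator_closure hδ
        tendsto_one_div_add_atTop_nhds_zero_nat s) y
      rw [hs.closure_eq] at h1
      have h2 := ((NNReal.continuous_coe.tendsto _).comp h1).mul_const (h y)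
      refine (h2.congr fun n => rfl).trans_eq ?_
      by_cases hy : y ∈ s <;> simp [hy]
  rw [← integral_indicator hs.measurableSet]
  refine tendsto_nhds_unique hlim ?_
  simp only [h0]
  exact tendsto_const_nhds

/-- An integral operator whose kernel vanishes nowhere separates continuous functions from zero, at
every point, after multiplication by suitable continuous functions. -/
theorem exists_integral_kernel_mul_ne_zero {X : Type*} [PseudoEMetricSpace X]
    [MeasurableSpace X] [BorelSpace X] [CompactSpace X] {ν : Measure X} [ν.IsOpenPosMeasure]
    {k : X → ℝ} (hk : Integrable k ν) (hk0 : ∀ y, k y ≠ 0) {f : C(X, ℝ)} (hf : f ≠ 0) :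
    ∃ φ : C(X, ℝ), ∫ y, k y * (f * φ) y ∂ν ≠ 0 := by
  by_contra! hcon
  have hint : Integrable (fun y => f y * k y) ν :=
    hk.bdd_mul (c := ‖f‖) f.continuous.aestronglyMeasurable
      (Filter.Eventually.of_forall f.norm_coe_le_norm)
  -- `f * k` vanishes almost everywhere, hence so does `f`; continuity and positivity of `ν` on open
  -- sets then give `f = 0`.
  have h0 := ae_eq_zero_of_forall_integral_continuous_mul_eq_zero hint fun φ => by
    rw [← hcon φ]
    congr 1
    ext y
    simp only [ContinuousMap.mul_apply]
    ring
  have h1 : f =ᵐ[ν] (fun _ => (0 : ℝ)) := by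
    filter_upwards [h0] with y hy
    exact (mul_eq_zero.1 hy).resolve_right (hk0 y)
  refine hf (ContinuousMap.ext fun y => ?_)
  exact congrFun ((f.continuous.ae_eq_iff_eq ν continuous_const).1 h1) y

/-- The `i`-th component of a vector-valued continuous function. -/
noncomputable def coordCLM (X : Type*) [TopologicalSpace X] [CompactSpace X] {n : ℕ} (i : Fin n) :
    C(X, EuclideanSpace ℝ (Fin n)) →L[ℝ] C(X, ℝ) :=
  (EuclideanSpace.proj i : EuclideanSpace ℝ (Fin n) →L[ℝ] ℝ).compLeftContinuous ℝ X

theorem coordCLM_apply {X : Type*} [TopologicalSpace X] [CompactSpace X] {n : ℕ} (i : Fin n)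
    (u : C(X, EuclideanSpace ℝ (Fin n))) (x : X) : coordCLM X i u x = u x i := rfl

/-- The map `u ↦ ∑ i, uᵢ fᵢ`. -/
noncomputable def weightedSum {X : Type*} [TopologicalSpace X] [CompactSpace X] {n : ℕ}
    (f : Fin n → C(X, ℝ)) (u : C(X, EuclideanSpace ℝ (Fin n))) : C(X, ℝ) :=
  ∑ i, coordCLM X i u * f i

theorem continuous_weightedSum {X : Type*} [TopologicalSpace X] [CompactSpace X] {n : ℕ}
    (f : Fin n → C(X, ℝ)) : Continuous (weightedSum f) := by
  unfold weightedSum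
  fun_prop

/-- A map `(u, x) ↦ G u x` is approximated by shallow networks whose inputs are `p x` and values at
`x` of `I (∑ i, uᵢ fᵢ)`, where `I` is an integral operator with nowhere vanishing kernel. -/
theorem exists_neurons_approx_operator (σ : C(ℝ, ℝ))
    (hσ_poly : ¬ ∃ q : Polynomial ℝ, ∀ t, σ t = q.eval t) {X : Type*} [PseudoEMetricSpace X]
    [CompactSpace X] [MeasurableSpace X] [BorelSpace X] {ν : Measure X} [ν.IsOpenPosMeasure]
    {m dᵢ : ℕ} {p : X → Fin m → ℝ} (hp : Continuous p) (hp_inj : Function.Injective p)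
    (I : C(X, ℝ) →L[ℝ] C(X, ℝ)) {k : X → X → ℝ} (hk : ∀ x, Integrable (k x) ν)
    (hI : ∀ f x, I f x = ∫ y, k x y * f y ∂ν) (hk0 : ∀ x y, k x y ≠ 0)
    (K : Set C(X, EuclideanSpace ℝ (Fin dᵢ))) [CompactSpace K] {ρ : Type*} [Finite ρ]
    (G : ρ → C(K × X, ℝ)) {ε : ℝ} (hε : 0 < ε) :
    ∃ (N : ℕ) (α : Fin N → Fin m → ℝ) (b : Fin N → ℝ) (f : Fin N → Fin dᵢ → C(X, ℝ))
      (c : ρ → Fin N → ℝ), ∀ r (u : K) x,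
        |∑ j, c r j * σ (α j ⬝ᵥ p x + b j + I (weightedSum (f j) u) x) - G r (u, x)| < ε := by
  have hcont : ∀ f : Fin dᵢ → C(X, ℝ),
      Continuous fun z : K × X => I (weightedSum f z.1) z.2 := fun f => by
    have h1 : Continuous fun z : K × X => I (weightedSum f z.1) :=
      I.continuous.comp ((continuous_weightedSum f).comp (by fun_prop))
    exact ContinuousEval.continuous_eval.comp (h1.prodMk continuous_snd)
  -- The preactivation is linear in `(α, b, f)`, so its range is an admissible linear space.
  let Φ : (Fin m → ℝ) × ℝ × (Fin dᵢ → C(X, ℝ)) →ₗ[ℝ] C(K × X, ℝ) :=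
    { toFun := fun a => ⟨fun z => a.1 ⬝ᵥ p z.2 + a.2.1 + I (weightedSum a.2.2 z.1) z.2, by
        refine Continuous.add ?_ (hcont a.2.2)
        unfold dotProduct
        fun_prop⟩
      map_add' := fun a b => by
        ext z
        simp [weightedSum, add_dotProduct, mul_add, Finset.sum_add_distrib]
        ring
      map_smul' := fun a b => by
        ext z
        simp [weightedSum, smul_dotProduct, ← Finset.smul_sum]
        ring }
  have hsep : ∀ y z : K × X, y ≠ z → ∃ a, Φ a y ≠ Φ a z := by
    intro y z hyz
    by_contra! hcon
    have hx : y.2 = z.2 := hp_inj <| funext fun i => by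
      simpa [Φ, weightedSum] using hcon (Pi.single i 1, 0, 0)
    have hu : y.1 ≠ z.1 := fun hu => hyz (Prod.ext hu hx)
    obtain ⟨i, hi⟩ : ∃ i, coordCLM X i (y.1 : C(X, EuclideanSpace ℝ (Fin dᵢ))) - coordCLM X i z.1 ≠ 0 := by
      by_contra! hall
      refine hu (Subtype.ext (ContinuousMap.ext fun x => ?_))
      ext i
      have := congrArg (fun f : C(X, ℝ) => f x) (hall i)
      simpa [coordCLM_apply, sub_eq_zero] using this
    obtain ⟨φ, hφ⟩ := exists_integral_kernel_mul_ne_zero (hk z.2) (hk0 z.2) hi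
    rw [← hI, sub_mul, map_sub, ContinuousMap.sub_apply, sub_ne_zero] at hφ
    have hws : ∀ u : C(X, EuclideanSpace ℝ (Fin dᵢ)),
        weightedSum (Pi.single i φ) u = coordCLM X i u * φ := fun u => by
      rw [weightedSum, Finset.sum_eq_single i]
      · simp
      · intro j _ hj
        simp [hj]
      · simp
    have := hcon (0, 0, Pi.single i φ)
    simp only [Φ, LinearMap.coe_mk, AddHom.coe_mk, ContinuousMap.coe_mk, zero_dotProduct, zero_add,
      hws, hx] at this
    exact hφ this
  obtain ⟨N, a, c, h⟩ := exists_neurons_approx_of_linearMap σ hσ_poly Φ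
    ⟨(0, 1, 0), by ext z; simp [Φ, weightedSum]⟩ hsep G hε
  exact ⟨N, fun j => (a j).1, fun j => (a j).2.1, fun j => (a j).2.2, c, fun r u x => h r (u, x)⟩

/-! ### Assembly of the operator network. -/

/-- A continuous map composed with uniformly small perturbations of compactly many points. -/
theorem exists_dist_comp_lt {A B S : Type*} [PseudoMetricSpace A] [PseudoMetricSpace B]
    [TopologicalSpace S] [CompactSpace S] {Q : A → B} (hQ : Continuous Q) {t : S → A}
    (ht : Continuous t) {ε : ℝ} (hε : 0 < ε) :
    ∃ δ > 0, ∀ s y, dist (t s) y ≤ δ → dist (Q (t s)) (Q y) < ε := by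
  have h := (isCompact_range ht).uniformContinuousAt_of_continuousAt Q
    (fun a _ => hQ.continuousAt) (Metric.dist_mem_uniformity hε)
  obtain ⟨δ, hδ, h⟩ := Metric.mem_uniformity_dist.1 h
  refine ⟨δ / 2, half_pos hδ, fun s y hy => ?_⟩
  exact h (hy.trans_lt (half_lt_self hδ)) ⟨s, rfl⟩

theorem ConvArchitecture.FullFieldOfView.isUniversal {X E : Type*} [PseudoEMetricSpace X]
    [CompactSpace X] [MeasurableSpace X] [BorelSpace X] [AddCommGroup E] [MeasurableSpace E]
    [MeasurableSub₂ E] {ι : X → E} (hι : MeasurableEmbedding ι) {ν : Measure X}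
    [ν.IsOpenPosMeasure] {L : ℕ} {𝒜 : ConvArchitecture.{u} ι L} (h𝒜 : 𝒜.FullFieldOfView ν)
    {σ : ℝ → ℝ} (hσ : Continuous σ) (hσ_poly : ¬ ∃ q : Polynomial ℝ, ∀ t, σ t = q.eval t)
    {m : ℕ} {p : X → Fin m → ℝ} (hp : Continuous p) (hp_inj : Function.Injective p)
    (dᵢ dₒ : ℕ) : 𝒜.IsUniversal σ p dᵢ dₒ := by
  intro G hG K hK ε hε
  obtain ⟨g, ⟨k, ⟨hk, hkI⟩, hk0⟩, hker⟩ := h𝒜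
  have : CompactSpace K := isCompact_iff_compactSpace.1 hK
  -- At width `1` with all matrices `1`, the kernels are the `g ℓ` themselves, so they inherit
  -- `continuous_conv`.
  have hg : ∀ ℓ, ∀ f : C(X, ℝ), Continuous (domainConv ι (g ℓ) f) := by
    intro ℓ f
    obtain ⟨θ, hθ⟩ := hker 1 (fun _ => 1) (layerProduct_ne_zero _ one_ne_zero (by simp)) ℓ
    have := 𝒜.continuous_conv 1 ℓ θ 0 0 f
    rwa [hθ 0 0, Matrix.one_apply_eq, one_smul] at this
  let s : C(ℝ, ℝ) := ⟨σ, hσ⟩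
  set T := fun ℓ => domainConvCLM hι (g ℓ) (hg ℓ)
  let Gc : Fin dₒ → C(K × X, ℝ) := fun r => ⟨fun z => G z.1 z.2 r, by
    have h1 : Continuous fun z : K × X => G z.1 z.2 :=
      ContinuousEval.continuous_eval.comp
        ((hG.comp (continuous_subtype_val.comp continuous_fst)).prodMk continuous_snd)
    exact (EuclideanSpace.proj r : EuclideanSpace ℝ (Fin dₒ) →L[ℝ] ℝ).continuous.comp h1⟩
  obtain ⟨N, α, b, f, c, happ⟩ := exists_neurons_approx_operator s hσ_poly hp hp_inj
    (layerOperator T 0 1) hk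
    (fun f x => by rw [layerOperator_domainConvCLM_apply]; exact hkI f x) hk0 K Gc
    -- The errors of `dₒ` components add up to at most `ε / 2`; the `+ 1` covers `dₒ = 0`.
    (ε := ε / 2 / (dₒ + 1)) (by positivity)
  let Q : (Fin m ⊕ Fin N → ℝ) → EuclideanSpace ℝ (Fin dₒ) := fun y => WithLp.toLp 2 fun r =>
    ∑ j, c r j * s (α j ⬝ᵥ (fun i => y (Sum.inl i)) + b j + y (Sum.inr j))
  have hQ : Continuous Q := by
    refine (PiLp.continuous_toLp 2 _).comp (continuous_pi fun r => ?_)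
    unfold dotProduct
    fun_prop
  -- Position signals pass through unchanged, weights `(1, 0)`; product signals are convolved in
  -- every layer, weights `(0, 1)`.
  let w₁ : Fin m ⊕ Fin N → ℝ := Sum.elim (fun _ => 1) fun _ => 0
  let w₂ : Fin m ⊕ Fin N → ℝ := Sum.elim (fun _ => 0) fun _ => 1
  let h₀ : Fin m ⊕ Fin N → C(EuclideanSpace ℝ (Fin dᵢ) × X, ℝ) :=
    Sum.elim (fun i => ⟨fun z => p z.2 i, by fun_prop⟩)
      fun j => ⟨fun z => ∑ i, z.1 i * f j i z.2, by fun_prop⟩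
  let t : Fin m ⊕ Fin N → K → C(X, ℝ) :=
    Sum.elim (fun i _ => ⟨fun x => p x i, by fun_prop⟩) fun j u => weightedSum (f j) u
  have ht_apply : ∀ r (u : K) x, t r u x = h₀ r ((u : C(X, EuclideanSpace ℝ (Fin dᵢ))) x, x) := by
    rintro (i | j) u x
    · rfl
    · simp [t, h₀, weightedSum, ContinuousMap.sum_apply, coordCLM_apply]
  have htc : ∀ r, Continuous (t r) := by
    rintro (i | j)
    · exact continuous_const
    · exact (continuous_weightedSum (f j)).comp continuous_subtype_val
  have ht : ∃ R, ∀ r u, ‖t r u‖ ≤ R := by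
    obtain ⟨R, hR⟩ := (isCompact_range (continuous_pi htc)).isBounded.exists_norm_le
    exact ⟨R, fun r u => (norm_le_pi_norm (fun r => t r u) r).trans (hR _ ⟨u, rfl⟩)⟩
  -- The ideal readout; compactness of its range yields the tolerance `δ` of `Q`.
  let y₀ : K × X → Fin m ⊕ Fin N → ℝ := fun z r => layerOperator T (w₁ r) (w₂ r) (t r z.1) z.2
  have hy₀ : Continuous y₀ := continuous_pi fun r =>
    ContinuousEval.continuous_eval.comp ((((layerOperator T (w₁ r) (w₂ r)).continuous.comp
      (htc r)).comp continuous_fst).prodMk continuous_snd)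
  obtain ⟨δ, hδ, hQδ⟩ := exists_dist_comp_lt hQ hy₀ (half_pos hε)
  obtain ⟨δ₁, hδ₁, N₁, hlayers⟩ := exists_composeLayers_approx s hσ_poly hι w₁ w₂ L g hg t ht δ hδ
  obtain ⟨R, hR⟩ := hK.isBounded.exists_norm_le
  obtain ⟨N₂, hlift⟩ := exists_shallowNet_lift s hσ_poly hp hp_inj h₀ R hδ₁
  obtain ⟨n, hn₀, hn₁, hn₂⟩ : ∃ n, N ≤ n ∧ N₁ ≤ n ∧ N₂ ≤ n :=
    ⟨max N (max N₁ N₂), by simp, by simp, by simp⟩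
  obtain ⟨net, M, hM, hnet⟩ := hlift n hn₂
  obtain ⟨W, A, β, M', hA, -, -, hfin⟩ := hlayers n hn₁ M
    (fun u x => net.eval σ (Sum.elim (fun i => (u : C(X, EuclideanSpace ℝ (Fin dᵢ))) x i) (p x))) hM
    (fun u i => (continuous_apply i).comp ((net.continuous_eval s).comp (continuous_pi (by
      rintro (i | i)
      · exact (coordCLM X i (u : C(X, EuclideanSpace ℝ (Fin dᵢ)))).continuous
      · exact (continuous_apply i).comp hp))))
    (fun u x r => by
      rw [ht_apply]
      exact hnet _ x r ((ContinuousMap.norm_coe_le_norm _ x).trans (hR _ u.2)))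
  have hA0 : layerProduct A ≠ 0 :=
    layerProduct_ne_zero A (x := Pi.single 0 1) (by simp) hA
  choose θ hθ using fun ℓ => hker (n + 1) A hA0 ℓ
  have hθ' : ∀ ℓ, 𝒜.kernel (n + 1) ℓ (θ ℓ) = fun i j => A ℓ i j • g ℓ :=
    fun ℓ => funext fun i => funext fun j => hθ ℓ i j
  -- The linear readout `M'` is absorbed into the input weights of the outer neurons.
  obtain ⟨proj, hproj⟩ := exists_shallowNet_proj σ hn₀
    (fun j => ∑ i, α j i • M' (Sum.inl i) + M' (Sum.inr j)) b c
  refine ⟨n + 1, ⟨net, W, β, θ, proj⟩, fun u hu x => ?_⟩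
  have hQop : ConvArchitecture.Weights.operator (𝒜 := 𝒜) ⟨net, W, β, θ, proj⟩ σ p u x =
      Q (M'.mulVec (composeLayers L
        (fun ℓ => hiddenLayer ι s (W ℓ) (β ℓ) (fun i j => A ℓ i j • g ℓ))
        (fun x => net.eval σ (Sum.elim (fun i => u x i) (p x))) x)) := by
    simp only [ConvArchitecture.Weights.operator, hθ', Q]
    congr 1
    funext r
    rw [hproj]
    refine Finset.sum_congr rfl fun j _ => ?_
    congr 2
    simp only [add_dotProduct, sum_dotProduct, smul_dotProduct, Matrix.mulVec]
    simp only [dotProduct, smul_eq_mul]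
    exact add_right_comm _ _ _
  have h1 : ‖G u x - Q (y₀ (⟨u, hu⟩, x))‖ ≤ ε / 2 := by
    refine (EuclideanSpace.norm_le_sum_abs _).trans ?_
    calc _ ≤ ∑ _r : Fin dₒ, ε / 2 / (dₒ + 1) := Finset.sum_le_sum fun r _ => by
          have h2 := (happ r ⟨u, hu⟩ x).le
          rw [abs_sub_comm] at h2
          have h3 : Q (y₀ (⟨u, hu⟩, x)) r = ∑ j, c r j *
              s ((α j ⬝ᵥ fun i => p x i) + b j + layerOperator T 0 1 (weightedSum (f j) u) x) := by
            simp [Q, y₀, w₁, w₂, t, layerOperator_one_zero]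
          rw [PiLp.sub_apply, h3]
          exact h2
      _ = dₒ * (ε / 2 / (dₒ + 1)) := by simp
      _ ≤ (dₒ + 1) * (ε / 2 / (dₒ + 1)) := by gcongr; linarith
      _ = ε / 2 := by field_simp
  have h2 := hQδ (⟨u, hu⟩, x) _ ((dist_pi_le_iff hδ.le).2 fun r => by
    rw [dist_comm, Real.dist_eq]
    exact hfin ⟨u, hu⟩ x r)
  rw [hQop]
  refine (norm_sub_le_norm_sub_add_norm_sub _ (Q (y₀ (⟨u, hu⟩, x))) _).trans ?_
  rw [dist_eq_norm] at h2
  exact (add_le_add h1 h2.le).trans_eq (add_halves ε)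

theorem isOpenPosMeasure_comap_subtype {α : Type*} [TopologicalSpace α] [MeasurableSpace α]
    {μ : Measure α} {D : Set α} (hD : MeasurableSet D)
    (h : ∀ x ∈ D, ∀ U ∈ nhds x, 0 < μ (U ∩ D)) :
    (μ.comap (fun x : D => (x : α))).IsOpenPosMeasure := by
  refine ⟨fun V hV hne => ?_⟩
  obtain ⟨U, hU, rfl⟩ := isOpen_induced_iff.1 hV
  obtain ⟨x, hx⟩ := hne
  have := h x x.2 U (hU.mem_nhds hx)
  rw [show (fun x : D => (x : α)) = Subtype.val from rfl,
    (MeasurableEmbedding.subtype_coe hD).comap_apply, Subtype.image_preimage_coe, Set.inter_comm]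
  exact this.ne'

theorem theorem1 (σ : ℝ → ℝ) (hσ : Continuous σ)
    (hσ_poly : ¬ ∃ q : Polynomial ℝ, ∀ t, σ t = q.eval t) (d dᵢ dₒ L : ℕ) :
    (∀ D : Set (EuclideanSpace ℝ (Fin d)), IsCompact D →
      (∀ x ∈ D, ∀ U ∈ nhds x, 0 < volume (U ∩ D)) →
      ∀ 𝒜 : ConvArchitecture.{u} (fun x : D => (x : EuclideanSpace ℝ (Fin d))) L,
        𝒜.FullFieldOfView (volume.comap (fun x : D => (x : EuclideanSpace ℝ (Fin d)))) →
        𝒜.IsUniversal σ (fun (x : D) (i : Fin d) => (x : EuclideanSpace ℝ (Fin d)) i) dᵢ dₒ) ∧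
    (∀ (T : ℝ) [Fact (0 < T)] (m : ℕ) (p : (Fin d → AddCircle T) → Fin m → ℝ),
      Continuous p → Function.Injective p →
      ∀ 𝒜 : ConvArchitecture.{u} (fun x : Fin d → AddCircle T => x) L,
        𝒜.FullFieldOfView volume →
        𝒜.IsUniversal σ p dᵢ dₒ) := by
  refine ⟨fun D hD hpos 𝒜 h𝒜 => ?_, fun T _ m p hp hp_inj 𝒜 h𝒜 => ?_⟩
  · have : CompactSpace D := isCompact_iff_compactSpace.1 hD
    have hDm := hD.isClosed.measurableSet
    have := isOpenPosMeasure_comap_subtype hDm hpos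
    refine h𝒜.isUniversal (MeasurableEmbedding.subtype_coe hDm) hσ hσ_poly (by fun_prop)
      (fun x y hxy => Subtype.ext ?_) dᵢ dₒ
    ext i
    exact congrFun hxy i
  · exact h𝒜.isUniversal MeasurableEmbedding.id hσ hσ_poly hp hp_inj dᵢ dₒ
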